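/- There is an absolute constant $C>0$ such that the following holds. Let $K\ge 2$, let $\mathcal X$ be a measurable space, $[K]=\{1,\dots,K\}$, and let $\mathcal H\subseteq[K]^{\mathcal X}$ be a class of (measurable) hypotheses. For a probability distribution $\mathcal D$ on $\mathcal X\times[K]$ write $\mathrm{loss}_{\mathcal D}(h)=\mathbb P_{(x,y)\sim\mathcal D}(h(x)\ne y)$, and call $\mathcal D$ realizable if $\mathrm{loss}_{\mathcal D}(h^\star)=0$ for some $h^\star\in\mathcal H$. Randomized algorithms output hypotheses in a set $\mathcal F\subseteq[K]^{\mathcal X}$ equipped with a $\sigma$-algebra for which the evaluation map $\mathcal F\times\mathcal X\to[K]$ and the relation of equality on $\mathcal F$ are measurable (if $\mathcal X$ is countable and discrete, one may take $\mathcal F=[K]^{\mathcal X}$); an algorithm on $n$ samples is a Markov kernel from $(\mathcal X\times[K])^n$ to $\mathcal F$. It is $(\epsilon,\delta)$-differentially private if $\mathbb P(\mathcal A(S)\in T)\le e^{\epsilon}\,\mathbb P(\mathcal A(S')\in T)+\delta$ for all samples $S,S'$ that differ in exactly one example and all measurable $T\subseteq\mathcal F$. Let $m\ge 0$ be an integer,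 let $\eta\in(0,1]$, $\alpha\in(0,1)$, $\beta\in(0,1/2)$, $\epsilon,\delta\in(0,1)$, and let $G:(\mathcal X\times[K])^m\to\mathcal F$ be a randomized algorithm. Then for some integer $$0\le n\le C\left(\frac{m\log(1/(\eta\beta\delta))}{\eta\epsilon}+\frac{\log(1/(\eta\beta))}{\alpha\epsilon}\right)$$ there exists an $(\epsilon,\delta)$-differentially private algorithm $M:(\mathcal X\times[K])^n\to\mathcal F$, not depending on $\mathcal D$, with the following property. For every realizable distribution $\mathcal D$ for which there is a hypothesis $h\in\mathcal F$ with $$\mathbb P_{S\sim\mathcal D^m}\big(G(S)=h\big)\ge\eta\quad\text{and}\quad\mathrm{loss}_{\mathcal D}(h)\le\alpha/2,$$ the output $\hat h=M(S)$ on $n$ i.i.d. samples $S\sim\mathcal D^n$ satisfies $\mathrm{loss}_{\mathcal D}(\hat h)\le\alpha$ with probability at least $1-\beta$ (over $S$ and the randomness of $M$). In particular, if $G$ has the displayed property for every realizable $\mathcal D$ (with $h$ depending on $\mathcal D$), then the accuracy guarantee of $M$ holds for every realizable $\mathcal D$. -/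

import Mathlib

open MeasureTheory ProbabilityTheory
open scoped ENNReal

noncomputable section

/-- A labelled sample of `n` examples from `X × [K]`, the labels `[K]` being `Fin K`. -/
abbrev LabelledSample (X : Type*) (K n : ℕ) : Type _ := Fin n → X × Fin K

/-- The standard zero-one loss of predicting `y'` when the true label is `y`. -/
def zeroOneLoss {K : ℕ} (y' y : Fin K) : ℝ := if y' = y then 0 else 1

/-- The population loss `𝔼_{(x, y) ∼ D} [ℓ(h x; y)]` with respect to the zero-one loss. -/
def populationLoss {X : Type*} [MeasurableSpace X] {K : ℕ}
    (D : Measure (X × Fin K)) (h : X → Fin K) : ℝ :=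
  ∫ z, zeroOneLoss (h z.1) z.2 ∂D

/-- `D` is realizable with respect to the hypothesis class `H`. -/
def Realizable {X : Type*} [MeasurableSpace X] {K : ℕ}
    (H : Set (X → Fin K)) (D : Measure (X × Fin K)) : Prop :=
  ∃ h ∈ H, populationLoss D h = 0

/-- Two samples are neighboring if they differ in exactly one example. -/
def Neighboring {X : Type*} {K n : ℕ} (S S' : LabelledSample X K n) : Prop :=
  ∃ i, S i ≠ S' i ∧ ∀ j, j ≠ i → S j = S' j

/-- A randomized algorithm is a Markov kernel `A` from samples to outputs: `A S` is the law of
the output on the sample `S`. It is `(ε, δ)`-differentially private if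
`ℙ (A S ∈ T) ≤ exp ε * ℙ (A S' ∈ T) + δ` for all neighboring `S`, `S'` and all measurable `T`. -/
def DifferentiallyPrivate {X : Type*} [MeasurableSpace X] {K n : ℕ}
    {Out : Type*} [MeasurableSpace Out]
    (ε δ : ℝ) (A : Kernel (LabelledSample X K n) Out) : Prop :=
  ∀ S S' : LabelledSample X K n, Neighboring S S' → ∀ T : Set Out, MeasurableSet T →
    A S T ≤ ENNReal.ofReal (Real.exp ε) * A S' T + ENNReal.ofReal δ

/-- The law of the output `A(S)` of the randomized algorithm `A` when `S ∼ D^n`,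
over the draw of `S` and the internal randomness of `A`. -/
def outputLaw {X : Type*} [MeasurableSpace X] {K n : ℕ} {Out : Type*} [MeasurableSpace Out]
    (A : Kernel (LabelledSample X K n) Out) (D : Measure (X × Fin K)) : Measure Out :=
  (Measure.pi fun _ : Fin n => D).bind A

end

/-! Split the sample into `k` batches of size `m` and a validation sample of size `l`. Run `G` on
each batch and select privately among the `k` candidates. With `s = ε / 4` and `q = exp s`, a
hypothesis `h` occurring `c` times gets weight `w(c) * exp (-s * errors)`, where the errors are
counted on the validation sample. A fixed fallback `h₀` gets extra weight `1`.

Privacy: `w(0) = 0` and `w(c + 1) ≤ q * w(c) + d`, so replacing one candidate changes unnormalized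
masses by at most a factor `q` plus `d`. Replacing one validation example costs a factor `q`. The
total mass is at least `1` thanks to `h₀`, so normalizing gives `q ^ 2` and `(1 + q) * d`, within
`(ε, δ)` for `d = δ / 4` (`normalize_le`, `batchSelectionKernel_le`).

Accuracy: a hypothesis `h` that `G` outputs with probability at least `η` occurs at least `c₀`
times, except with small probability, once `k` is of order `c₀ / η`. Then the total mass is at least
`w(c₀)` times the validation weight of `h`. The growth of `w` is geometric, so `c₀` of order `log (1
/ (η * β * δ)) / ε` makes `h₀` negligible. Since `w(c) / c ≤ w(c₀) / c₀`, the bad candidates carry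
expected mass at most `k / c₀` times an exponential moment of the loss difference
(`selectionKernel_comp_le`). The ratio `k / c₀` is of order `1 / η`, free of `δ` and `m`, so `l`
needs only `log (1 / (η * β)) / (α * ε)`. -/

/-! ### Product measures: resampling a coordinate, splitting into batches. -/

theorem lintegral_pi_prod {ι : Type*} [Fintype ι] {Ω : ι → Type*} [∀ i, MeasurableSpace (Ω i)]
    (μ : ∀ i, Measure (Ω i)) [∀ i, IsProbabilityMeasure (μ i)] {f : ∀ i, Ω i → ℝ≥0∞}
    (hf : ∀ i, Measurable (f i)) :
    ∫⁻ x, ∏ i, f i (x i) ∂Measure.pi μ = ∏ i, ∫⁻ x, f i x ∂μ i := by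
  have h := lintegral_prod_eq_prod_lintegral_of_indepFun (μ := Measure.pi μ) Finset.univ
    (fun i (x : ∀ i, Ω i) => f i (x i)) (iIndepFun_pi fun i => (hf i).aemeasurable)
    fun i => (hf i).comp (measurable_pi_apply i)
  rw [h]
  refine Finset.prod_congr rfl fun i _ => ?_
  exact (measurePreserving_eval μ i).lintegral_comp (hf i)

/-- The kernel that applies `κ` independently to each coordinate. -/
noncomputable def piKernel {ι A B : Type*} [Fintype ι] [MeasurableSpace A] [MeasurableSpace B]
    (κ : Kernel A B) [IsMarkovKernel κ] : Kernel (ι → A) (ι → B) where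
  toFun a := Measure.pi fun i => κ (a i)
  measurable' := by
    refine Measurable.measure_of_isPiSystem_of_isProbabilityMeasure generateFrom_pi.symm
      isPiSystem_pi ?_
    rintro _ ⟨s, hs, rfl⟩
    simp only [Measure.pi_pi]
    exact Finset.measurable_prod _ fun i _ =>
      (κ.measurable_coe (hs i (Set.mem_univ i))).comp (measurable_pi_apply i)

theorem piKernel_apply {ι A B : Type*} [Fintype ι] [MeasurableSpace A] [MeasurableSpace B]
    (κ : Kernel A B) [IsMarkovKernel κ] (a : ι → A) :
    piKernel κ a = Measure.pi fun i => κ (a i) := rfl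

instance {ι A B : Type*} [Fintype ι] [MeasurableSpace A] [MeasurableSpace B]
    (κ : Kernel A B) [IsMarkovKernel κ] : IsMarkovKernel (piKernel (ι := ι) κ) :=
  ⟨fun a => by rw [piKernel_apply]; infer_instance⟩

theorem pi_bind_piKernel {ι A B : Type*} [Fintype ι] [MeasurableSpace A] [MeasurableSpace B]
    (κ : Kernel A B) [IsMarkovKernel κ] (μ : Measure A) [IsProbabilityMeasure μ] :
    (Measure.pi fun _ : ι => μ).bind (piKernel κ) = Measure.pi fun _ : ι => μ.bind κ := by
  symm
  refine Measure.pi_eq fun s hs => ?_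
  rw [Measure.bind_apply (MeasurableSet.univ_pi hs) (Kernel.aemeasurable _)]
  simp only [piKernel_apply, Measure.pi_pi]
  rw [lintegral_pi_prod (fun _ : ι => μ) fun i => κ.measurable_coe (hs i)]
  exact Finset.prod_congr rfl fun i _ =>
    (Measure.bind_apply (hs i) (Kernel.aemeasurable _)).symm

theorem map_update_pi_prod {ι : Type*} [Fintype ι] [DecidableEq ι] {Ω : Type*} [MeasurableSpace Ω]
    (μ ν : ι → Measure Ω) [∀ i, IsProbabilityMeasure (μ i)] [∀ i, IsProbabilityMeasure (ν i)]
    (j : ι) (h : ∀ i, i ≠ j → μ i = ν i) :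
    ((Measure.pi ν).prod (μ j)).map (fun p => Function.update p.1 j p.2) = Measure.pi μ := by
  have hm : Measurable fun p : (ι → Ω) × Ω => Function.update p.1 j p.2 := by
    refine measurable_pi_iff.2 fun i => ?_
    rcases eq_or_ne i j with rfl | hi
    · simpa using measurable_snd
    · simp only [Function.update_of_ne hi]
      exact (measurable_pi_apply i).comp measurable_fst
  symm
  refine Measure.pi_eq fun s hs => ?_
  rw [Measure.map_apply hm (MeasurableSet.univ_pi hs)]
  have : (fun p : (ι → Ω) × Ω => Function.update p.1 j p.2) ⁻¹' Set.univ.pi s =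
      (Set.univ.pi (Function.update s j Set.univ)) ×ˢ s j := by
    ext p
    simp only [Set.mem_preimage, Set.mem_pi, Set.mem_univ, true_imp_iff, Set.mem_prod]
    constructor
    · refine fun hp => ⟨fun i => ?_, by simpa using hp j⟩
      rcases eq_or_ne i j with rfl | hi
      · simp
      · simpa [hi] using hp i
    · rintro ⟨h1, h2⟩ i
      rcases eq_or_ne i j with rfl | hi
      · simpa using h2
      · simpa [hi] using h1 i
  rw [this, Measure.prod_prod, Measure.pi_pi, ← Finset.prod_erase_mul _ _ (Finset.mem_univ j),
    ← Finset.prod_erase_mul Finset.univ (fun i => μ i (s i)) (Finset.mem_univ j)]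
  simp only [Function.update_self, measure_univ, mul_one]
  congr 1
  refine Finset.prod_congr rfl fun i hi => ?_
  have hi := Finset.ne_of_mem_erase hi
  simp [hi, h i hi]

/-- A coupling: the first product law arises from the second by redrawing coordinate `j`
independently. A pointwise stability bound under one update therefore passes to expectations. -/
theorem lintegral_pi_le_of_update_le {ι : Type*} [Fintype ι] [DecidableEq ι] {Ω : Type*}
    [MeasurableSpace Ω] (μ ν : ι → Measure Ω) [∀ i, IsProbabilityMeasure (μ i)]
    [∀ i, IsProbabilityMeasure (ν i)] (j : ι) (h : ∀ i, i ≠ j → μ i = ν i)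
    {F : (ι → Ω) → ℝ≥0∞} (hF : Measurable F) {c d : ℝ≥0∞}
    (hcd : ∀ f x, F (Function.update f j x) ≤ c * F f + d) :
    ∫⁻ f, F f ∂Measure.pi μ ≤ c * ∫⁻ f, F f ∂Measure.pi ν + d := by
  have hm : Measurable fun p : (ι → Ω) × Ω => Function.update p.1 j p.2 := by
    refine measurable_pi_iff.2 fun i => ?_
    rcases eq_or_ne i j with rfl | hi
    · simpa using measurable_snd
    · simp only [Function.update_of_ne hi]
      exact (measurable_pi_apply i).comp measurable_fst
  rw [← map_update_pi_prod μ ν j h, lintegral_map hF hm]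
  calc _ ≤ ∫⁻ p, (c * F p.1 + d) ∂((Measure.pi ν).prod (μ j)) :=
        lintegral_mono fun p => hcd p.1 p.2
    _ = _ := by
        rw [lintegral_add_right _ measurable_const,
          lintegral_const_mul _ (f := fun p : (ι → Ω) × Ω => F p.1) (hF.comp measurable_fst)]
        simp only [lintegral_const, measure_univ, mul_one]
        congr 2
        exact (measurePreserving_fst (μ := Measure.pi ν) (ν := μ j)).lintegral_comp hF

theorem map_split_pi {κ₁ κ₂ κ₃ ι A : Type*} [Fintype κ₁] [Fintype κ₂] [Fintype κ₃] [Fintype ι]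
    [MeasurableSpace A] (μ : Measure A) [IsProbabilityMeasure μ] (e : (κ₁ × κ₂) ⊕ κ₃ ≃ ι) :
    (Measure.pi fun _ : ι => μ).map
        (fun S => ((fun j i => S (e (.inl (j, i))), fun i => S (e (.inr i))) :
          (κ₁ → κ₂ → A) × (κ₃ → A))) =
      (Measure.pi fun _ : κ₁ => Measure.pi fun _ : κ₂ => μ).prod (Measure.pi fun _ : κ₃ => μ) := by
  have h1 := (measurePreserving_piCongrLeft (fun _ : ι => μ) e).symm
  have h2 := measurePreserving_sumPiEquivProdPi (fun _ : (κ₁ × κ₂) ⊕ κ₃ => μ)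
  have h3 : MeasurePreserving (MeasurableEquiv.curry κ₁ κ₂ A) (Measure.pi fun _ : κ₁ × κ₂ => μ)
      (Measure.pi fun _ : κ₁ => Measure.pi fun _ : κ₂ => μ) := by
    refine ⟨(MeasurableEquiv.curry κ₁ κ₂ A).measurable, ?_⟩
    have := Measure.infinitePi_map_curry (ι := κ₁) (κ := κ₂) (fun _ _ => μ)
    simpa only [Measure.infinitePi_eq_pi] using this
  have h4 := (h3.prod (MeasurePreserving.id (Measure.pi fun _ : κ₃ => μ))).comp (h2.comp h1)
  exact h4.map_eq

/-! ### The weight of a multiplicity. -/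

section CountWeight

/-- The weight `d * (1 + q + ⋯ + q ^ (min c c₀ - 1))` of an output that occurs `c` times. -/
noncomputable def countWeight (q d : ℝ≥0∞) (c₀ c : ℕ) : ℝ≥0∞ :=
  d * ∑ i ∈ Finset.range (min c c₀), q ^ i

@[simp] theorem countWeight_zero (q d : ℝ≥0∞) (c₀ : ℕ) : countWeight q d c₀ 0 = 0 := by
  simp [countWeight]

theorem countWeight_mono (q d : ℝ≥0∞) (c₀ : ℕ) : Monotone (countWeight q d c₀) := by
  intro a b h
  unfold countWeight
  gcongr

theorem countWeight_of_le {q d : ℝ≥0∞} {c₀ c : ℕ} (h : c₀ ≤ c) :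
    countWeight q d c₀ c = countWeight q d c₀ c₀ := by
  simp [countWeight, h]

/-- The recursion `w ↦ q * w + d` generates the geometric sum, and the cap at `c₀` only helps. This
is the privacy property of the weight. -/
theorem countWeight_succ_le (q d : ℝ≥0∞) (c₀ c : ℕ) :
    countWeight q d c₀ (c + 1) ≤ q * countWeight q d c₀ c + d := by
  have h : min (c + 1) c₀ ≤ min c c₀ + 1 := by omega
  calc countWeight q d c₀ (c + 1) ≤ d * ∑ i ∈ Finset.range (min c c₀ + 1), q ^ i := by
        unfold countWeight
        gcongr
    _ = _ := by
        rw [Finset.sum_range_succ', countWeight]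
        simp only [pow_succ, ← Finset.sum_mul]
        ring

theorem countWeight_ne_top {q d : ℝ≥0∞} (hq : q ≠ ∞) (hd : d ≠ ∞) (c₀ c : ℕ) :
    countWeight q d c₀ c ≠ ∞ :=
  ENNReal.mul_ne_top hd (ENNReal.sum_ne_top.2 fun _ _ => ENNReal.pow_ne_top hq)

/-- Averages of the increasing sequence `q ^ i` increase, so `w(c) / c` is at most `w(c₀) / c₀` up
to `c₀`; beyond, `w` is constant. Each entry of the list is thus charged at most `w(c₀) / c₀`,
whatever its multiplicity. -/
theorem mul_countWeight_le {q d : ℝ≥0∞} (hq : 1 ≤ q) (c₀ c : ℕ) :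
    c₀ * countWeight q d c₀ c ≤ c * countWeight q d c₀ c₀ := by
  rcases le_total c₀ c with h | h
  · rw [countWeight_of_le h]
    gcongr
  · simp only [countWeight, min_eq_left h, min_self]
    rw [mul_left_comm, mul_left_comm (c : ℝ≥0∞)]
    gcongr d * ?_
    obtain ⟨r, rfl⟩ := Nat.exists_eq_add_of_le h
    rw [Finset.sum_range_add, mul_add]
    push_cast
    rw [add_mul]
    refine add_le_add le_rfl ?_
    calc (r : ℝ≥0∞) * ∑ i ∈ Finset.range c, q ^ i
        ≤ r * ∑ i ∈ Finset.range c, q ^ c := by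
          gcongr with i hi
          exact (Finset.mem_range.1 hi).le
      _ = c * ∑ i ∈ Finset.range r, q ^ c := by simp; ring
      _ ≤ c * ∑ i ∈ Finset.range r, q ^ (c + i) := by
          gcongr
          omega

end CountWeight

/-! ### Private selection from a list of candidates. -/

section Selection

variable {Y Z ι J : Type*} [Fintype ι] [Fintype J]

open Classical in
/-- The number of occurrences of `h` in the list `f`. -/
noncomputable def occurrences (f : J → Y) (h : Y) : ℕ := ∑ j, if f j = h then 1 else 0

/-- The weight `exp (-s * ∑ i, u h (z i))` of `h` on the sample `z`. -/
noncomputable def sampleWeight (s : ℝ) (u : Y → Z → ℝ) (h : Y) (z : ι → Z) : ℝ≥0∞ :=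
  ∏ i, ENNReal.ofReal (Real.exp (-(s * u h (z i))))

/-- The unnormalized law of the selected output. -/
noncomputable def selectionMeasure [MeasurableSpace Y] (q d : ℝ≥0∞) (c₀ : ℕ) (s : ℝ)
    (u : Y → Z → ℝ) (h₀ : Y) (f : J → Y) (z : ι → Z) : Measure Y :=
  Measure.dirac h₀ + ∑ j, (countWeight q d c₀ (occurrences f (f j)) / occurrences f (f j) *
    sampleWeight s u (f j) z) • Measure.dirac (f j)

theorem occurrences_self_ne_zero (f : J → Y) (j : J) : occurrences f (f j) ≠ 0 := by
  classical
  unfold occurrences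
  intro h
  have := Finset.sum_eq_zero_iff.1 h j (Finset.mem_univ j)
  simp at this

open Classical in
theorem occurrences_update_le [DecidableEq J] (f : J → Y) (j : J) (x h : Y) :
    occurrences (Function.update f j x) h ≤ occurrences f h + if x = h then 1 else 0 := by
  unfold occurrences
  rw [← Finset.add_sum_erase _ _ (Finset.mem_univ j),
    ← Finset.add_sum_erase _ (fun i => if f i = h then 1 else 0) (Finset.mem_univ j)]
  have : ∑ i ∈ Finset.univ.erase j, (if Function.update f j x i = h then 1 else 0) =
      ∑ i ∈ Finset.univ.erase j, (if f i = h then 1 else 0) :=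
    Finset.sum_congr rfl fun i hi => by rw [Function.update_of_ne (Finset.ne_of_mem_erase hi)]
  rw [this, Function.update_self]
  split_ifs <;> omega

/-- Each value `h` appears in the list `occurrences f h` times, cancelling the denominator. The
finite sum suits measurability and accuracy; the sum over values suits privacy. -/
theorem sum_div_occurrences (g : ℕ → ℝ≥0∞) (hg : g 0 = 0) (φ : Y → ℝ≥0∞) (f : J → Y) :
    ∑ j, g (occurrences f (f j)) / occurrences f (f j) * φ (f j) =
      ∑' h, g (occurrences f h) * φ h := by
  classical
  calc _ = ∑ j, ∑' h, if h = f j then g (occurrences f h) / occurrences f h * φ h else 0 := by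
        simp only [tsum_ite_eq]
    _ = ∑' h, ∑ j, if h = f j then g (occurrences f h) / occurrences f h * φ h else 0 :=
        (Summable.tsum_finsetSum fun _ _ => ENNReal.summable).symm
    _ = _ := by
        refine tsum_congr fun h => ?_
        have : ∀ j, (if h = f j then g (occurrences f h) / occurrences f h * φ h else 0) =
            ((if f j = h then 1 else 0 : ℕ) : ℝ≥0∞) *
              (g (occurrences f h) / occurrences f h * φ h) := by
          intro j
          by_cases hj : h = f j
          · simp [← hj]
          · simp [hj, Ne.symm hj]
        rw [Finset.sum_congr rfl fun j _ => this j, ← Finset.sum_mul, ← Nat.cast_sum,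
          ← mul_assoc]
        change (occurrences f h : ℝ≥0∞) * _ * _ = _
        congr 1
        by_cases h0 : occurrences f h = 0
        · simp [h0, hg]
        · exact ENNReal.mul_div_cancel (by exact_mod_cast h0) (by simp)

theorem sampleWeight_le_one {s : ℝ} (hs : 0 ≤ s) {u : Y → Z → ℝ} (hu : ∀ h z, 0 ≤ u h z) (h : Y)
    (z : ι → Z) : sampleWeight s u h z ≤ 1 := by
  refine Finset.prod_le_one (fun _ _ => zero_le) fun i _ => ?_
  rw [ENNReal.ofReal_le_one, Real.exp_le_one_iff]
  have := mul_nonneg hs (hu h (z i))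
  linarith

theorem sampleWeight_ne_zero (s : ℝ) (u : Y → Z → ℝ) (h : Y) (z : ι → Z) :
    sampleWeight s u h z ≠ 0 :=
  Finset.prod_ne_zero_iff.2 fun _ _ => by simp [Real.exp_pos]

theorem sampleWeight_ne_top (s : ℝ) (u : Y → Z → ℝ) (h : Y) (z : ι → Z) :
    sampleWeight s u h z ≠ ∞ :=
  ENNReal.prod_ne_top fun _ _ => ENNReal.ofReal_ne_top

theorem sampleWeight_le_of_eq_of_ne {s : ℝ} (hs : 0 ≤ s) {u : Y → Z → ℝ} (hu : ∀ h z, 0 ≤ u h z)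
    (hu' : ∀ h z, u h z ≤ 1) (h : Y) {z z' : ι → Z} {j : ι} (hz : ∀ i, i ≠ j → z i = z' i) :
    sampleWeight s u h z ≤ ENNReal.ofReal (Real.exp s) * sampleWeight s u h z' := by
  classical
  unfold sampleWeight
  rw [← Finset.mul_prod_erase _ _ (Finset.mem_univ j), ← Finset.mul_prod_erase _
    (fun i => ENNReal.ofReal (Real.exp (-(s * u h (z' i))))) (Finset.mem_univ j), ← mul_assoc,
    Finset.prod_congr rfl fun i hi => by rw [hz i (Finset.ne_of_mem_erase hi)]]
  gcongr
  rw [← ENNReal.ofReal_mul (Real.exp_pos _).le, ← Real.exp_add]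
  gcongr
  have := mul_nonneg hs (hu h (z j))
  have := mul_le_of_le_one_right hs (hu' h (z' j))
  linarith

variable [MeasurableSpace Y]

theorem selectionMeasure_apply (q d : ℝ≥0∞) (c₀ : ℕ) (s : ℝ)
    (u : Y → Z → ℝ) (h₀ : Y) (f : J → Y) (z : ι → Z) {T : Set Y} (hT : MeasurableSet T) :
    selectionMeasure q d c₀ s u h₀ f z T = T.indicator 1 h₀ +
      ∑ j, countWeight q d c₀ (occurrences f (f j)) / occurrences f (f j) *
        (sampleWeight s u (f j) z * T.indicator 1 (f j)) := by
  simp [selectionMeasure, Measure.dirac_apply' _ hT, mul_assoc]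

theorem selectionMeasure_apply_eq_tsum (q d : ℝ≥0∞) (c₀ : ℕ) (s : ℝ)
    (u : Y → Z → ℝ) (h₀ : Y) (f : J → Y) (z : ι → Z) {T : Set Y} (hT : MeasurableSet T) :
    selectionMeasure q d c₀ s u h₀ f z T = T.indicator 1 h₀ +
      ∑' h, countWeight q d c₀ (occurrences f h) *
        (sampleWeight s u h z * T.indicator 1 h) := by
  rw [selectionMeasure_apply _ _ _ _ _ _ _ _ hT,
    sum_div_occurrences (countWeight q d c₀) (countWeight_zero _ _ _)
      (fun h => sampleWeight s u h z * T.indicator 1 h)]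

theorem one_le_selectionMeasure_univ (q d : ℝ≥0∞) (c₀ : ℕ) (s : ℝ)
    (u : Y → Z → ℝ) (h₀ : Y) (f : J → Y) (z : ι → Z) :
    1 ≤ selectionMeasure q d c₀ s u h₀ f z Set.univ := by
  rw [selectionMeasure_apply _ _ _ _ _ _ _ _ .univ]
  simp

theorem countWeight_mul_sampleWeight_le (q d : ℝ≥0∞) (c₀ : ℕ) (s : ℝ)
    (u : Y → Z → ℝ) (h₀ : Y) (f : J → Y) (z : ι → Z) (h : Y) :
    countWeight q d c₀ (occurrences f h) * sampleWeight s u h z ≤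
      selectionMeasure q d c₀ s u h₀ f z Set.univ := by
  rw [selectionMeasure_apply_eq_tsum _ _ _ _ _ _ _ _ .univ]
  refine le_trans ?_ le_add_self
  refine le_trans (le_of_eq ?_) (ENNReal.le_tsum h)
  simp

theorem selectionMeasure_univ_ne_top {q d : ℝ≥0∞} (hq : q ≠ ∞) (hd : d ≠ ∞) (c₀ : ℕ) (s : ℝ)
    (u : Y → Z → ℝ) (h₀ : Y) (f : J → Y) (z : ι → Z) :
    selectionMeasure q d c₀ s u h₀ f z Set.univ ≠ ∞ := by
  rw [selectionMeasure_apply _ _ _ _ _ _ _ _ .univ]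
  refine ENNReal.add_ne_top.2 ⟨by simp, ENNReal.sum_ne_top.2 fun j _ => ?_⟩
  refine ENNReal.mul_ne_top (ENNReal.div_ne_top (countWeight_ne_top hq hd _ _) ?_) ?_
  · exact_mod_cast occurrences_self_ne_zero f j
  · simpa using sampleWeight_ne_top s u (f j) z

/-- Only the inserted value `x` can gain an occurrence, and only one, so the additive error `d` is
paid once; all other weights do not increase. -/
theorem selectionMeasure_update_le [DecidableEq J] {q : ℝ≥0∞} (hq : 1 ≤ q) (d : ℝ≥0∞) (c₀ : ℕ)
    {s : ℝ} (hs : 0 ≤ s) {u : Y → Z → ℝ} (hu : ∀ h z, 0 ≤ u h z) (h₀ : Y) (f : J → Y) (j : J)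
    (x : Y) (z : ι → Z) {T : Set Y} (hT : MeasurableSet T) :
    selectionMeasure q d c₀ s u h₀ (Function.update f j x) z T ≤
      q * selectionMeasure q d c₀ s u h₀ f z T + d := by
  classical
  simp only [selectionMeasure_apply_eq_tsum _ _ _ _ _ _ _ _ hT]
  rw [mul_add, add_assoc]
  refine add_le_add (le_mul_of_one_le_left zero_le hq) ?_
  calc _ ≤ ∑' h, (q * (countWeight q d c₀ (occurrences f h) *
          (sampleWeight s u h z * T.indicator 1 h)) + if h = x then d else 0) := by
        refine ENNReal.tsum_le_tsum fun h => ?_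
        have h1 : sampleWeight s u h z * T.indicator 1 h ≤ 1 :=
          mul_le_one' (sampleWeight_le_one hs hu h z)
            (Set.indicator_le_self' (fun _ _ => zero_le) h)
        have h2 := occurrences_update_le f j x h
        by_cases hx : h = x
        · rw [if_pos hx.symm] at h2
          rw [if_pos hx]
          calc _ ≤ (q * countWeight q d c₀ (occurrences f h) + d) *
                (sampleWeight s u h z * T.indicator 1 h) :=
                mul_le_mul_left ((countWeight_mono q d c₀ h2).trans
                  (countWeight_succ_le q d c₀ _)) _
            _ ≤ _ := by
                rw [add_mul, mul_assoc]
                gcongr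
                exact mul_le_of_le_one_right zero_le h1
        · rw [if_neg (Ne.symm hx), add_zero] at h2
          rw [if_neg hx, add_zero]
          refine le_trans ?_ (le_mul_of_one_le_left zero_le hq)
          exact mul_le_mul_left (countWeight_mono q d c₀ h2) _
    _ = _ := by rw [ENNReal.tsum_add, ENNReal.tsum_mul_left, tsum_ite_eq]

theorem selectionMeasure_le_of_eq_of_ne (d : ℝ≥0∞) (c₀ : ℕ) {s : ℝ} (hs : 0 ≤ s)
    {u : Y → Z → ℝ} (hu : ∀ h z, 0 ≤ u h z) (hu' : ∀ h z, u h z ≤ 1) (h₀ : Y) (f : J → Y)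
    {z z' : ι → Z} {j : ι} (hz : ∀ i, i ≠ j → z i = z' i) {T : Set Y} (hT : MeasurableSet T) :
    selectionMeasure (ENNReal.ofReal (Real.exp s)) d c₀ s u h₀ f z T ≤
      ENNReal.ofReal (Real.exp s) *
        selectionMeasure (ENNReal.ofReal (Real.exp s)) d c₀ s u h₀ f z' T + d := by
  -- The comparison is purely multiplicative; `d` is there only to match the form required by
  -- `normalize_le`.
  refine le_trans ?_ le_self_add
  simp only [selectionMeasure_apply _ _ _ _ _ _ _ _ hT]
  rw [mul_add, Finset.mul_sum]
  have hq : 1 ≤ ENNReal.ofReal (Real.exp s) := by simpa using hs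
  refine add_le_add (le_mul_of_one_le_left zero_le hq) (Finset.sum_le_sum fun i _ => ?_)
  refine (mul_le_mul_right (mul_le_mul_left
    (sampleWeight_le_of_eq_of_ne hs hu hu' (f i) hz) _) _).trans_eq ?_
  ring

/-- If `μ ≤ q ν + d` and `ν ≤ q μ + d`, normalization changes the constants to `q ^ 2` and
`(1 + q) d`. -/
theorem normalize_le {μ ν : Measure Y} {q d : ℝ≥0∞} {T : Set Y} (hT : μ T ≤ q * ν T + d)
    (huniv : ν Set.univ ≤ q * μ Set.univ + d) (hμ : 1 ≤ μ Set.univ) (hν : 1 ≤ ν Set.univ)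
    (hμ' : μ Set.univ ≠ ∞) (hν' : ν Set.univ ≠ ∞) :
    (μ Set.univ)⁻¹ * μ T ≤ q ^ 2 * ((ν Set.univ)⁻¹ * ν T) + (1 + q) * d := by
  set a := μ Set.univ
  set b := ν Set.univ
  have ha : a⁻¹ ≤ 1 := ENNReal.inv_le_one.2 hμ
  have ha0 : a ≠ 0 := (one_pos.trans_le hμ).ne'
  have hb0 : b ≠ 0 := (one_pos.trans_le hν).ne'
  have h1 : b⁻¹ * ν T ≤ 1 := by
    rw [mul_comm, ← div_eq_mul_inv]
    exact ENNReal.div_le_of_le_mul (by simpa using measure_mono (Set.subset_univ T))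
  -- The lower bound `1 ≤ a`, supplied by the fallback, keeps the additive error from growing on
  -- division.
  have h2 : a⁻¹ * b ≤ q + d := by
    calc a⁻¹ * b ≤ a⁻¹ * (q * a + d) := by gcongr
      _ = (a⁻¹ * a) * q + a⁻¹ * d := by ring
      _ ≤ _ := by
        rw [ENNReal.inv_mul_cancel ha0 hμ', one_mul]
        gcongr
        exact mul_le_of_le_one_left zero_le ha
  have h3 : ν T = b * (b⁻¹ * ν T) := by
    rw [← mul_assoc, ENNReal.mul_inv_cancel hb0 hν', one_mul]
  calc a⁻¹ * μ T ≤ a⁻¹ * (q * ν T + d) := by gcongr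
    _ = q * ((a⁻¹ * b) * (b⁻¹ * ν T)) + a⁻¹ * d := by
        conv_lhs => rw [h3]
        ring
    _ ≤ q * ((q + d) * (b⁻¹ * ν T)) + 1 * d := by gcongr
    _ = q ^ 2 * (b⁻¹ * ν T) + q * d * (b⁻¹ * ν T) + d := by ring
    _ ≤ q ^ 2 * (b⁻¹ * ν T) + q * d * 1 + d := by gcongr
    _ = _ := by ring

variable [MeasurableSpace Z]

theorem measurable_sampleWeight {Ω : Type*} [MeasurableSpace Ω] (s : ℝ) {u : Y → Z → ℝ}
    (hu : Measurable (Function.uncurry u)) {h : Ω → Y} {z : Ω → ι → Z}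
    (hh : Measurable h) (hz : Measurable z) :
    Measurable fun ω => sampleWeight s u (h ω) (z ω) := by
  unfold sampleWeight
  refine Finset.measurable_fun_prod _ fun i _ => ?_
  have : Measurable fun ω => u (h ω) (z ω i) :=
    hu.comp (hh.prodMk ((measurable_pi_apply i).comp hz))
  fun_prop

variable [MeasurableEq Y]

@[fun_prop]
theorem measurable_occurrences {Ω : Type*} [MeasurableSpace Ω] {f : Ω → J → Y} {h : Ω → Y}
    (hf : Measurable f) (hh : Measurable h) : Measurable fun ω => occurrences (f ω) (h ω) := by
  classical
  unfold occurrences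
  refine Finset.measurable_fun_sum _ fun j _ => ?_
  exact Measurable.ite (measurableSet_eq_fun ((measurable_pi_apply j).comp hf) hh)
    measurable_const measurable_const

theorem measurable_selectionMeasure (q d : ℝ≥0∞) (c₀ : ℕ) (s : ℝ) {u : Y → Z → ℝ}
    (hu : Measurable (Function.uncurry u)) (h₀ : Y) :
    Measurable fun p : (J → Y) × (ι → Z) => selectionMeasure q d c₀ s u h₀ p.1 p.2 := by
  refine Measure.measurable_of_measurable_coe _ fun T hT => ?_
  simp only [selectionMeasure_apply _ _ _ _ _ _ _ _ hT]
  refine measurable_const.add (Finset.measurable_fun_sum _ fun j _ => ?_)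
  have hj : Measurable fun p : (J → Y) × (ι → Z) => p.1 j := by fun_prop
  have ho : Measurable fun p : (J → Y) × (ι → Z) => occurrences p.1 (p.1 j) := by fun_prop
  refine Measurable.mul ((Measurable.of_discrete (f := fun c : ℕ =>
    countWeight q d c₀ c / c)).comp ho) ?_
  exact (measurable_sampleWeight s hu hj measurable_snd).mul
    ((measurable_one.indicator hT).comp hj)

/-- The kernel that selects an output from a list of candidates using a sample. -/
noncomputable def selectionKernel (q d : ℝ≥0∞) (c₀ : ℕ) (s : ℝ) {u : Y → Z → ℝ}
    (hu : Measurable (Function.uncurry u)) (h₀ : Y) : Kernel ((J → Y) × (ι → Z)) Y where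
  toFun p := (selectionMeasure q d c₀ s u h₀ p.1 p.2 Set.univ)⁻¹ •
    selectionMeasure q d c₀ s u h₀ p.1 p.2
  measurable' := by
    have h := measurable_selectionMeasure (J := J) (ι := ι) q d c₀ s hu h₀
    refine Measure.measurable_of_measurable_coe _ fun T hT => ?_
    simp only [Measure.smul_apply, smul_eq_mul]
    exact ((Measure.measurable_coe .univ).comp h).inv.mul ((Measure.measurable_coe hT).comp h)

theorem selectionKernel_apply (q d : ℝ≥0∞) (c₀ : ℕ) (s : ℝ) {u : Y → Z → ℝ}
    (hu : Measurable (Function.uncurry u)) (h₀ : Y) (f : J → Y) (z : ι → Z) (T : Set Y) :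
    selectionKernel q d c₀ s hu h₀ (f, z) T =
      (selectionMeasure q d c₀ s u h₀ f z Set.univ)⁻¹ *
        selectionMeasure q d c₀ s u h₀ f z T := rfl

theorem isMarkovKernel_selectionKernel {q d : ℝ≥0∞} (hq : q ≠ ∞) (hd : d ≠ ∞) (c₀ : ℕ) (s : ℝ)
    {u : Y → Z → ℝ} (hu : Measurable (Function.uncurry u)) (h₀ : Y) :
    IsMarkovKernel (selectionKernel (J := J) (ι := ι) q d c₀ s hu h₀) := by
  refine ⟨fun p => ⟨?_⟩⟩
  rw [selectionKernel_apply]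
  exact ENNReal.inv_mul_cancel
    (one_pos.trans_le (one_le_selectionMeasure_univ q d c₀ s u h₀ p.1 p.2)).ne'
    (selectionMeasure_univ_ne_top hq hd c₀ s u h₀ p.1 p.2)

theorem selectionKernel_update_le [DecidableEq J] {q d : ℝ≥0∞} (hq : 1 ≤ q) (hq' : q ≠ ∞)
    (hd : d ≠ ∞) (c₀ : ℕ) {s : ℝ} (hs : 0 ≤ s) {u : Y → Z → ℝ}
    (hu : Measurable (Function.uncurry u)) (hu0 : ∀ h z, 0 ≤ u h z) (h₀ : Y) (f : J → Y) (j : J)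
    (x : Y) (z : ι → Z) {T : Set Y} (hT : MeasurableSet T) :
    selectionKernel q d c₀ s hu h₀ (Function.update f j x, z) T ≤
      q ^ 2 * selectionKernel q d c₀ s hu h₀ (f, z) T + (1 + q) * d := by
  simp only [selectionKernel_apply]
  refine normalize_le (selectionMeasure_update_le hq d c₀ hs hu0 h₀ f j x z hT) ?_
    (one_le_selectionMeasure_univ ..) (one_le_selectionMeasure_univ ..)
    (selectionMeasure_univ_ne_top hq' hd _ _ _ _ _ _) (selectionMeasure_univ_ne_top hq' hd _ _ _ _ _ _)
  -- The reverse comparison is another update, restoring the old entry `f j`.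
  simpa using selectionMeasure_update_le hq d c₀ hs hu0 h₀ (Function.update f j x) j (f j) z .univ

theorem selectionKernel_le_of_eq_of_ne {d : ℝ≥0∞} (hd : d ≠ ∞) (c₀ : ℕ) {s : ℝ} (hs : 0 ≤ s)
    {u : Y → Z → ℝ} (hu : Measurable (Function.uncurry u)) (hu0 : ∀ h z, 0 ≤ u h z)
    (hu1 : ∀ h z, u h z ≤ 1) (h₀ : Y) (f : J → Y)
    {z z' : ι → Z} {j : ι} (hz : ∀ i, i ≠ j → z i = z' i) {T : Set Y} (hT : MeasurableSet T) :
    selectionKernel (ENNReal.ofReal (Real.exp s)) d c₀ s hu h₀ (f, z) T ≤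
      ENNReal.ofReal (Real.exp s) ^ 2 *
        selectionKernel (ENNReal.ofReal (Real.exp s)) d c₀ s hu h₀ (f, z') T +
      (1 + ENNReal.ofReal (Real.exp s)) * d := by
  simp only [selectionKernel_apply]
  exact normalize_le (selectionMeasure_le_of_eq_of_ne d c₀ hs hu0 hu1 h₀ f hz hT)
    (selectionMeasure_le_of_eq_of_ne d c₀ hs hu0 hu1 h₀ f (fun i hi => (hz i hi).symm) .univ)
    (one_le_selectionMeasure_univ ..) (one_le_selectionMeasure_univ ..)
    (selectionMeasure_univ_ne_top ENNReal.ofReal_ne_top hd _ _ _ _ _ _)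
    (selectionMeasure_univ_ne_top ENNReal.ofReal_ne_top hd _ _ _ _ _ _)

/-- The normalization is bounded below by the contribution of `h` alone, whose multiplicity weight
has reached its cap. The first term pays for the fallback, the sum for the candidates in `T`. -/
theorem selectionKernel_le_of_le_occurrences {q d : ℝ≥0∞} (hq : 1 ≤ q) (hq' : q ≠ ∞)
    (hd0 : d ≠ 0) (hd : d ≠ ∞) {c₀ : ℕ} (hc₀ : c₀ ≠ 0) (s : ℝ) {u : Y → Z → ℝ}
    (hu : Measurable (Function.uncurry u)) (h₀ : Y) (f : J → Y) (z : ι → Z) {h : Y}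
    (hh : c₀ ≤ occurrences f h) {T : Set Y} (hT : MeasurableSet T) :
    selectionKernel q d c₀ s hu h₀ (f, z) T ≤
      (countWeight q d c₀ c₀)⁻¹ * (sampleWeight s u h z)⁻¹ +
        ∑ j, (c₀ : ℝ≥0∞)⁻¹ * (T.indicator 1 (f j) *
          (sampleWeight s u (f j) z * (sampleWeight s u h z)⁻¹)) := by
  have hB0 : countWeight q d c₀ c₀ ≠ 0 := by
    refine mul_ne_zero hd0 fun h0 => ?_
    have := Finset.sum_eq_zero_iff.1 h0 0 (by simpa using Nat.pos_of_ne_zero hc₀)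
    simp at this
  have hB := countWeight_ne_top hq' hd c₀ c₀
  have hW := countWeight_mul_sampleWeight_le q d c₀ s u h₀ f z h
  rw [countWeight_of_le hh] at hW
  have hS0 := sampleWeight_ne_zero s u h z
  have hS := sampleWeight_ne_top s u h z
  rw [selectionKernel_apply, selectionMeasure_apply _ _ _ _ _ _ _ _ hT]
  set B := countWeight q d c₀ c₀
  set W := sampleWeight s u h z
  calc _ ≤ (B * W)⁻¹ * (1 + ∑ j, (c₀ : ℝ≥0∞)⁻¹ * B *
        (sampleWeight s u (f j) z * T.indicator 1 (f j))) := by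
        gcongr with j
        · exact Set.indicator_le_self' (fun _ _ => zero_le) h₀
        · refine ENNReal.div_le_of_le_mul ?_
          calc countWeight q d c₀ (occurrences f (f j))
              = (c₀ : ℝ≥0∞)⁻¹ * (c₀ * countWeight q d c₀ (occurrences f (f j))) := by
                rw [← mul_assoc, ENNReal.inv_mul_cancel (by exact_mod_cast hc₀) (by simp),
                  one_mul]
            _ ≤ (c₀ : ℝ≥0∞)⁻¹ * (occurrences f (f j) * B) := by
                exact mul_le_mul_right (mul_countWeight_le hq _ _) _
            _ = _ := by ring
    _ = B⁻¹ * W⁻¹ + ∑ j, (B⁻¹ * B) * ((c₀ : ℝ≥0∞)⁻¹ * (T.indicator 1 (f j) *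
          (sampleWeight s u (f j) z * W⁻¹))) := by
        rw [ENNReal.mul_inv (.inl hB0) (.inl hB), mul_add, mul_one, Finset.mul_sum]
        congr 1
        refine Finset.sum_congr rfl fun j _ => ?_
        ring
    _ = _ := by simp only [ENNReal.inv_mul_cancel hB0 hB, one_mul]

end Selection

/-! ### Exponential moments and accuracy of the selection. -/

section Utility

variable {Y Z ι J : Type*} [Fintype ι] [Fintype J]

theorem inv_sampleWeight (s : ℝ) (u : Y → Z → ℝ) (h : Y) (z : ι → Z) :
    (sampleWeight s u h z)⁻¹ = ∏ i, ENNReal.ofReal (Real.exp (s * u h (z i))) := by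
  unfold sampleWeight
  rw [ENNReal.prod_inv_distrib fun _ _ _ _ _ => .inr ENNReal.ofReal_ne_top]
  refine Finset.prod_congr rfl fun i _ => ?_
  rw [← ENNReal.ofReal_inv_of_pos (Real.exp_pos _), Real.exp_neg, inv_inv]

theorem sampleWeight_mul_inv_sampleWeight (s : ℝ) (u : Y → Z → ℝ) (b h : Y) (z : ι → Z) :
    sampleWeight s u b z * (sampleWeight s u h z)⁻¹ =
      ∏ i, ENNReal.ofReal (Real.exp (s * (u h (z i) - u b (z i)))) := by
  rw [inv_sampleWeight, sampleWeight, ← Finset.prod_mul_distrib]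
  refine Finset.prod_congr rfl fun i _ => ?_
  rw [← ENNReal.ofReal_mul (Real.exp_pos _).le, ← Real.exp_add]
  congr 2
  ring

theorem lintegral_pi_prod_le_pow [MeasurableSpace Z] (D : Measure Z) [IsProbabilityMeasure D]
    {g : Z → ℝ≥0∞} (hg : Measurable g) {a : ℝ≥0∞} (ha : ∫⁻ z, g z ∂D ≤ a) :
    ∫⁻ z, ∏ i, g (z i) ∂(Measure.pi fun _ : ι => D) ≤ a ^ Fintype.card ι := by
  rw [lintegral_pi_prod (fun _ : ι => D) fun _ => hg, Finset.prod_const, Finset.card_univ]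
  gcongr

theorem exp_mul_le {s a : ℝ} (ha : a = 0 ∨ a = 1) :
    Real.exp (s * a) ≤ 1 + (Real.exp s - 1) * a := by
  rcases ha with rfl | rfl <;> simp

theorem exp_mul_sub_le {s a b : ℝ} (ha : a = 0 ∨ a = 1) (hb : b = 0 ∨ b = 1) :
    Real.exp (s * (a - b)) ≤ 1 + (Real.exp s - 1) * a - (1 - Real.exp (-s)) * b := by
  have h1 := Real.add_one_le_exp s
  have h2 := Real.add_one_le_exp (-s)
  rcases ha with rfl | rfl <;> rcases hb with rfl | rfl <;> simp
  linarith

theorem exp_bounds {s : ℝ} (hs : 0 ≤ s) (hs' : s ≤ 1 / 4) :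
    Real.exp s - 1 ≤ s + s ^ 2 ∧ s - s ^ 2 ≤ 1 - Real.exp (-s) := by
  have h1 := Real.abs_exp_sub_one_sub_id_le (x := s) (by rw [abs_le]; constructor <;> linarith)
  have h2 := Real.abs_exp_sub_one_sub_id_le (x := -s) (by rw [abs_le]; constructor <;> linarith)
  rw [abs_le] at h1 h2
  constructor <;> nlinarith

theorem lintegral_exp_loss_le [MeasurableSpace Z] (D : Measure Z) [IsProbabilityMeasure D]
    {v : Z → ℝ} (hv : Measurable v) (hv' : ∀ z, v z = 0 ∨ v z = 1) {s α : ℝ} (hs : 0 ≤ s)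
    (hs' : s ≤ 1 / 4) (hα : 0 ≤ α) (hvα : ∫ z, v z ∂D ≤ α / 2) :
    ∫⁻ z, ENNReal.ofReal (Real.exp (s * v z)) ∂D ≤ ENNReal.ofReal (Real.exp (α * s)) := by
  have hvi : Integrable v D := by
    refine Integrable.of_bound hv.aestronglyMeasurable 1 (.of_forall fun z => ?_)
    rcases hv' z with h | h <;> simp [h]
  have hle : ∀ z, Real.exp (s * v z) ≤ 1 + (Real.exp s - 1) * v z := fun z => exp_mul_le (hv' z)
  have hi : Integrable (fun z => 1 + (Real.exp s - 1) * v z) D :=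
    (integrable_const 1).add (hvi.const_mul _)
  calc _ ≤ ∫⁻ z, ENNReal.ofReal (1 + (Real.exp s - 1) * v z) ∂D :=
        lintegral_mono fun z => ENNReal.ofReal_le_ofReal (hle z)
    _ = ENNReal.ofReal (∫ z, 1 + (Real.exp s - 1) * v z ∂D) :=
        (ofReal_integral_eq_lintegral_ofReal hi
          (.of_forall fun z => (Real.exp_pos _).le.trans (hle z))).symm
    _ ≤ _ := by
        refine ENNReal.ofReal_le_ofReal ?_
        rw [integral_add (integrable_const 1) (hvi.const_mul _), integral_const_mul]
        simp only [integral_const, probReal_univ, smul_eq_mul, one_mul]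
        have h1 := (exp_bounds hs hs').1
        have h0 := Real.add_one_le_exp s
        have h2 := Real.add_one_le_exp (α * s)
        have h3 : (Real.exp s - 1) * ∫ z, v z ∂D ≤ (s + s ^ 2) * (α / 2) :=
          (mul_le_mul_of_nonneg_left hvα (by linarith)).trans
            (mul_le_mul_of_nonneg_right h1 (by linarith))
        nlinarith [mul_nonneg hα hs]

/-- To second order in `s` the mean is at most `1 + (s + s²) * α / 2 - (s - s²) * α`, which is at
most `1 - α * s / 8` because `s ≤ 1 / 4`. -/
theorem lintegral_exp_loss_sub_le [MeasurableSpace Z] (D : Measure Z) [IsProbabilityMeasure D]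
    {v w : Z → ℝ} (hv : Measurable v) (hv' : ∀ z, v z = 0 ∨ v z = 1) (hw : Measurable w)
    (hw' : ∀ z, w z = 0 ∨ w z = 1) {s α : ℝ} (hs : 0 ≤ s)
    (hs' : s ≤ 1 / 4) (hα : 0 ≤ α) (hvα : ∫ z, v z ∂D ≤ α / 2) (hwα : α ≤ ∫ z, w z ∂D) :
    ∫⁻ z, ENNReal.ofReal (Real.exp (s * (v z - w z))) ∂D ≤
      ENNReal.ofReal (Real.exp (-(α * s / 8))) := by
  have hvi : Integrable v D := by
    refine Integrable.of_bound hv.aestronglyMeasurable 1 (.of_forall fun z => ?_)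
    rcases hv' z with h | h <;> simp [h]
  have hwi : Integrable w D := by
    refine Integrable.of_bound hw.aestronglyMeasurable 1 (.of_forall fun z => ?_)
    rcases hw' z with h | h <;> simp [h]
  have hle : ∀ z, Real.exp (s * (v z - w z)) ≤
      1 + (Real.exp s - 1) * v z - (1 - Real.exp (-s)) * w z :=
    fun z => exp_mul_sub_le (hv' z) (hw' z)
  have hi1 : Integrable (fun z => 1 + (Real.exp s - 1) * v z) D :=
    (integrable_const 1).add (hvi.const_mul _)
  calc _ ≤ ∫⁻ z, ENNReal.ofReal (1 + (Real.exp s - 1) * v z - (1 - Real.exp (-s)) * w z) ∂D :=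
        lintegral_mono fun z => ENNReal.ofReal_le_ofReal (hle z)
    _ = ENNReal.ofReal (∫ z, 1 + (Real.exp s - 1) * v z - (1 - Real.exp (-s)) * w z ∂D) :=
        (ofReal_integral_eq_lintegral_ofReal (hi1.sub (hwi.const_mul _))
          (.of_forall fun z => (Real.exp_pos _).le.trans (hle z))).symm
    _ ≤ _ := by
        refine ENNReal.ofReal_le_ofReal ?_
        rw [integral_sub hi1 (hwi.const_mul _), integral_add (integrable_const 1)
          (hvi.const_mul _), integral_const_mul, integral_const_mul]
        simp only [integral_const, probReal_univ, smul_eq_mul, one_mul]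
        obtain ⟨h1, h1'⟩ := exp_bounds hs hs'
        have h0 := Real.add_one_le_exp s
        have h2 := Real.add_one_le_exp (-(α * s / 8))
        have h3 : (Real.exp s - 1) * ∫ z, v z ∂D ≤ (s + s ^ 2) * (α / 2) :=
          (mul_le_mul_of_nonneg_left hvα (by linarith)).trans
            (mul_le_mul_of_nonneg_right h1 (by linarith))
        have h4 : (s - s ^ 2) * α ≤ (1 - Real.exp (-s)) * ∫ z, w z ∂D :=
          (mul_le_mul_of_nonneg_right h1' hα).trans
            (mul_le_mul_of_nonneg_left hwα (by nlinarith))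
        nlinarith [mul_nonneg hα hs]

variable [MeasurableSpace Y] [MeasurableEq Y]

/-- A Chernoff bound with base `1 / 2`: the indicator is at most `2 ^ c₀ * 2 ^ (-occurrences)`, and
each factor has mean at most `1 - η / 2`. -/
theorem measure_occurrences_lt_le (μ : Measure Y) [IsProbabilityMeasure μ] {h : Y} {η : ℝ}
    (hη : ENNReal.ofReal η ≤ μ {h}) (c₀ : ℕ) :
    (Measure.pi fun _ : J => μ) {f | occurrences f h < c₀} ≤
      ENNReal.ofReal (2 ^ c₀ * (1 - η / 2) ^ Fintype.card J) := by
  classical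
  have hmeas : MeasurableSet {h} := by
    exact measurableSet_eq_fun measurable_id measurable_const
  have hηp : η ≤ μ.real {h} := (ENNReal.ofReal_le_iff_le_toReal (measure_ne_top _ _)).1 hη
  have hp1 : μ.real {h} ≤ 1 := measureReal_le_one
  have hint : ∫⁻ y, (if y = h then 2⁻¹ else 1 : ℝ≥0∞) ∂μ ≤ ENNReal.ofReal (1 - η / 2) := by
    have : ∀ y, (if y = h then 2⁻¹ else 1 : ℝ≥0∞) =
        ({h} : Set Y).indicator (fun _ => 2⁻¹) y + ({h}ᶜ : Set Y).indicator (fun _ => 1) y := by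
      intro y
      by_cases hy : y = h <;> simp [hy]
    simp only [this]
    rw [lintegral_add_left (measurable_const.indicator hmeas), lintegral_indicator_const hmeas,
      lintegral_indicator_const hmeas.compl, one_mul, ← ofReal_measureReal,
      ← ofReal_measureReal, probReal_compl_eq_one_sub hmeas,
      show (2⁻¹ : ℝ≥0∞) = ENNReal.ofReal 2⁻¹ by
        rw [ENNReal.ofReal_inv_of_pos (by norm_num)]; simp,
      ← ENNReal.ofReal_mul (by norm_num),
      ← ENNReal.ofReal_add (by positivity) (by linarith)]
    refine ENNReal.ofReal_le_ofReal (by linarith)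
  have hocc : Measurable fun f : J → Y => occurrences f h :=
    measurable_occurrences measurable_id measurable_const
  calc (Measure.pi fun _ : J => μ) {f | occurrences f h < c₀}
      = ∫⁻ f, {f : J → Y | occurrences f h < c₀}.indicator 1 f ∂(Measure.pi fun _ : J => μ) := by
        rw [lintegral_indicator_one (measurableSet_lt hocc measurable_const)]
    _ ≤ ∫⁻ f, 2 ^ c₀ * ∏ j, (if f j = h then 2⁻¹ else 1 : ℝ≥0∞) ∂(Measure.pi fun _ : J => μ) := by
        refine lintegral_mono fun f => ?_
        by_cases hf : f ∈ {f : J → Y | occurrences f h < c₀}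
        swap
        · simp [Set.indicator_of_notMem hf]
        rw [Set.indicator_of_mem hf]
        have : ∏ j, (if f j = h then 2⁻¹ else 1 : ℝ≥0∞) = (2⁻¹) ^ occurrences f h := by
          rw [occurrences, ← Finset.prod_pow_eq_pow_sum]
          refine Finset.prod_congr rfl fun j _ => ?_
          split_ifs <;> simp
        rw [this]
        calc (1 : ℝ≥0∞) = 2 ^ c₀ * 2⁻¹ ^ c₀ := by
              rw [← mul_pow, ENNReal.mul_inv_cancel (by norm_num) (by norm_num), one_pow]
          _ ≤ _ := by
              gcongr 2 ^ c₀ * ?_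
              exact pow_le_pow_right_of_le_one' (by simp) (show occurrences f h < c₀ from hf).le
    _ ≤ 2 ^ c₀ * ENNReal.ofReal (1 - η / 2) ^ Fintype.card J := by
        have hg : Measurable fun y : Y => (if y = h then 2⁻¹ else 1 : ℝ≥0∞) :=
          Measurable.ite hmeas measurable_const measurable_const
        rw [lintegral_const_mul _ (f := fun f : J → Y => ∏ j, if f j = h then 2⁻¹ else 1)
          (Finset.measurable_fun_prod _ fun j _ => hg.comp (measurable_pi_apply j))]
        gcongr
        exact lintegral_pi_prod_le_pow μ hg hint
    _ = _ := by
        rw [ENNReal.ofReal_mul (by positivity),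
          ENNReal.ofReal_pow (show 0 ≤ 1 - η / 2 by linarith),
          ENNReal.ofReal_pow zero_le_two, ENNReal.ofReal_ofNat]

variable [MeasurableSpace Z]

/-- The candidates are independent of the validation sample, so for a fixed list the likelihood
ratios integrate to powers of `a` and `ρ`. Lists with too few copies of `h` are bounded by
probability one. -/
theorem selectionKernel_comp_le {q d : ℝ≥0∞} (hq : 1 ≤ q) (hq' : q ≠ ∞)
    (hd0 : d ≠ 0) (hd : d ≠ ∞) {c₀ : ℕ} (hc₀ : c₀ ≠ 0) (s : ℝ) {u : Y → Z → ℝ}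
    (hu : Measurable (Function.uncurry u)) (h₀ : Y) (μ : Measure Y) [IsProbabilityMeasure μ]
    (D : Measure Z) [IsProbabilityMeasure D] (h : Y) {T : Set Y} (hT : MeasurableSet T)
    {a ρ : ℝ≥0∞} (ha : ∫⁻ z, ENNReal.ofReal (Real.exp (s * u h z)) ∂D ≤ a)
    (hρ : ∀ b ∈ T, ∫⁻ z, ENNReal.ofReal (Real.exp (s * (u h z - u b z))) ∂D ≤ ρ) :
    ((Measure.pi fun _ : J => μ).prod (Measure.pi fun _ : ι => D)).bind
        (selectionKernel q d c₀ s hu h₀) T ≤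
      (Measure.pi fun _ : J => μ) {f | occurrences f h < c₀} +
        ((countWeight q d c₀ c₀)⁻¹ * a ^ Fintype.card ι +
          Fintype.card J * ((c₀ : ℝ≥0∞)⁻¹ * ρ ^ Fintype.card ι)) := by
  have := isMarkovKernel_selectionKernel (J := J) (ι := ι) hq' hd c₀ s hu h₀
  have huh : ∀ b, Measurable (u b) := fun b => hu.comp measurable_prodMk_left
  have hK := Kernel.measurable_coe (selectionKernel (J := J) (ι := ι) q d c₀ s hu h₀) hT
  rw [Measure.bind_apply hT (Kernel.aemeasurable _), lintegral_prod _ hK.aemeasurable]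
  have hocc : Measurable fun f : J → Y => occurrences f h :=
    measurable_occurrences measurable_id measurable_const
  have hset : MeasurableSet {f : J → Y | occurrences f h < c₀} :=
    measurableSet_lt hocc measurable_const
  have hm1 : Measurable fun x => ENNReal.ofReal (Real.exp (s * u h x)) := by
    have := huh h
    fun_prop
  set E := (countWeight q d c₀ c₀)⁻¹ * a ^ Fintype.card ι +
          Fintype.card J * ((c₀ : ℝ≥0∞)⁻¹ * ρ ^ Fintype.card ι) with hE
  calc _ ≤ ∫⁻ f, ({f : J → Y | occurrences f h < c₀}.indicator 1 f + E)
        ∂(Measure.pi fun _ : J => μ) := by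
        refine lintegral_mono fun f => ?_
        by_cases hf : occurrences f h < c₀
        · rw [Set.indicator_of_mem (by exact hf)]
          refine le_trans ?_ le_self_add
          calc _ ≤ ∫⁻ z, 1 ∂(Measure.pi fun _ : ι => D) := lintegral_mono fun z => prob_le_one
            _ = _ := by simp
        rw [Set.indicator_of_notMem (by exact hf), zero_add]
        have hm : ∀ j, Measurable fun z : ι → Z =>
            sampleWeight s u (f j) z * (sampleWeight s u h z)⁻¹ := fun j =>
          (measurable_sampleWeight s hu measurable_const measurable_id).mul
            (measurable_sampleWeight s hu measurable_const measurable_id).inv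
        have hm' : Measurable fun z : ι → Z => (sampleWeight s u h z)⁻¹ :=
          (measurable_sampleWeight s hu measurable_const measurable_id).inv
        calc _ ≤ ∫⁻ z, ((countWeight q d c₀ c₀)⁻¹ * (sampleWeight s u h z)⁻¹ +
                ∑ j, (c₀ : ℝ≥0∞)⁻¹ * (T.indicator 1 (f j) *
                  (sampleWeight s u (f j) z * (sampleWeight s u h z)⁻¹)))
                ∂(Measure.pi fun _ : ι => D) :=
              lintegral_mono fun z => selectionKernel_le_of_le_occurrences hq hq' hd0 hd hc₀ s hu
                h₀ f z (not_lt.1 hf) hT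
          _ = (countWeight q d c₀ c₀)⁻¹ *
                ∫⁻ z, (sampleWeight s u h z)⁻¹ ∂(Measure.pi fun _ : ι => D) +
                ∑ j, (c₀ : ℝ≥0∞)⁻¹ * (T.indicator 1 (f j) *
                  ∫⁻ z, sampleWeight s u (f j) z * (sampleWeight s u h z)⁻¹
                    ∂(Measure.pi fun _ : ι => D)) := by
              rw [lintegral_add_left (hm'.const_mul _), lintegral_const_mul _ hm',
                lintegral_finsetSum _ fun j _ => ((hm j).const_mul _).const_mul _]
              congr 1
              refine Finset.sum_congr rfl fun j _ => ?_
              rw [lintegral_const_mul _ ((hm j).const_mul _), lintegral_const_mul _ (hm j)]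
          _ ≤ (countWeight q d c₀ c₀)⁻¹ * a ^ Fintype.card ι +
                ∑ _j : J, (c₀ : ℝ≥0∞)⁻¹ * ρ ^ Fintype.card ι := by
              gcongr with j
              · simp only [inv_sampleWeight]
                exact lintegral_pi_prod_le_pow D hm1 ha
              · by_cases hj : f j ∈ T
                · simp only [sampleWeight_mul_inv_sampleWeight]
                  simp only [Set.indicator_of_mem hj, Pi.one_apply, one_mul]
                  refine lintegral_pi_prod_le_pow D
                    (g := fun z => ENNReal.ofReal (Real.exp (s * (u h z - u (f j) z)))) ?_
                    (hρ _ hj)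
                  have := huh h
                  have := huh (f j)
                  fun_prop
                · simp [hj]
          _ = E := by simp [hE]
    _ = _ := by
        rw [lintegral_add_right _ measurable_const, lintegral_indicator_one hset]
        simp

end Utility

/-! ### The learner built from batches, and its privacy. -/

section Learner

variable {Y Z κ₁ κ₂ κ₃ ι : Type*} [MeasurableSpace Z]

/-- Splits a sample into batches and a remaining sample. -/
def splitSample (e : (κ₁ × κ₂) ⊕ κ₃ ≃ ι) (S : ι → Z) : (κ₁ → κ₂ → Z) × (κ₃ → Z) :=
  (fun j i => S (e (.inl (j, i))), fun i => S (e (.inr i)))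

theorem measurable_splitSample (e : (κ₁ × κ₂) ⊕ κ₃ ≃ ι) :
    Measurable (splitSample e : (ι → Z) → _) := by
  unfold splitSample
  fun_prop

variable [Fintype κ₁] [Fintype κ₃] [MeasurableSpace Y] [MeasurableEq Y]

/-- Runs `G` on each batch of the sample and selects one of the outputs using the remaining
sample. -/
noncomputable def batchSelectionKernel (q d : ℝ≥0∞) (c₀ : ℕ) (s : ℝ) {u : Y → Z → ℝ}
    (hu : Measurable (Function.uncurry u)) (h₀ : Y) (G : Kernel (κ₂ → Z) Y) [IsMarkovKernel G]
    (e : (κ₁ × κ₂) ⊕ κ₃ ≃ ι) : Kernel (ι → Z) Y :=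
  selectionKernel q d c₀ s hu h₀ ∘ₖ ((piKernel G ∥ₖ Kernel.id) ∘ₖ
    Kernel.deterministic (splitSample e) (measurable_splitSample e))

theorem batchSelectionKernel_apply (q d : ℝ≥0∞) (c₀ : ℕ) (s : ℝ) {u : Y → Z → ℝ}
    (hu : Measurable (Function.uncurry u)) (h₀ : Y) (G : Kernel (κ₂ → Z) Y) [IsMarkovKernel G]
    (e : (κ₁ × κ₂) ⊕ κ₃ ≃ ι) (S : ι → Z) {T : Set Y} (hT : MeasurableSet T) :
    batchSelectionKernel q d c₀ s hu h₀ G e S T =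
      ∫⁻ f, selectionKernel q d c₀ s hu h₀ (f, (splitSample e S).2) T
        ∂(Measure.pi fun j => G ((splitSample e S).1 j)) := by
  have hK := Kernel.measurable_coe (selectionKernel (J := κ₁) (ι := κ₃) q d c₀ s hu h₀) hT
  rw [batchSelectionKernel, Kernel.comp_apply' _ _ _ hT, Kernel.comp_deterministic_eq_comap,
    Kernel.comap_apply, Kernel.lintegral_parallelComp_symm _ hK, Kernel.id_apply,
    lintegral_dirac' _ hK.lintegral_prod_left']
  rfl

theorem pi_bind_batchSelectionKernel [Fintype κ₂] [Fintype ι] (q d : ℝ≥0∞) (c₀ : ℕ) (s : ℝ)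
    {u : Y → Z → ℝ} (hu : Measurable (Function.uncurry u)) (h₀ : Y) (G : Kernel (κ₂ → Z) Y)
    [IsMarkovKernel G] (e : (κ₁ × κ₂) ⊕ κ₃ ≃ ι) (D : Measure Z) [IsProbabilityMeasure D] :
    (Measure.pi fun _ : ι => D).bind (batchSelectionKernel q d c₀ s hu h₀ G e) =
      ((Measure.pi fun _ : κ₁ => (Measure.pi fun _ : κ₂ => D).bind G).prod
        (Measure.pi fun _ : κ₃ => D)).bind (selectionKernel q d c₀ s hu h₀) := by
  have h := map_split_pi D e
  rw [batchSelectionKernel, ← Measure.comp_assoc, ← Measure.comp_assoc,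
    Measure.deterministic_comp_eq_map]
  unfold splitSample
  rw [h, ← Measure.prod_comp_left, pi_bind_piKernel]

/-- Each example lies either in one batch, affecting the law of a single candidate, or in the
validation sample. The two cases never occur together, so one budget covers both. -/
theorem batchSelectionKernel_le {d : ℝ≥0∞} (hd : d ≠ ∞) (c₀ : ℕ) {s : ℝ} (hs : 0 ≤ s)
    {u : Y → Z → ℝ} (hu : Measurable (Function.uncurry u)) (hu0 : ∀ h z, 0 ≤ u h z)
    (hu1 : ∀ h z, u h z ≤ 1) (h₀ : Y) (G : Kernel (κ₂ → Z) Y) [IsMarkovKernel G]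
    (e : (κ₁ × κ₂) ⊕ κ₃ ≃ ι) {S S' : ι → Z} {i : ι} (hS : ∀ j, j ≠ i → S j = S' j) {T : Set Y}
    (hT : MeasurableSet T) :
    batchSelectionKernel (ENNReal.ofReal (Real.exp s)) d c₀ s hu h₀ G e S T ≤
      ENNReal.ofReal (Real.exp s) ^ 2 *
        batchSelectionKernel (ENNReal.ofReal (Real.exp s)) d c₀ s hu h₀ G e S' T +
      (1 + ENNReal.ofReal (Real.exp s)) * d := by
  classical
  set q := ENNReal.ofReal (Real.exp s) with hqdef
  have hq : 1 ≤ q := by simpa [hqdef] using hs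
  have hK := Kernel.measurable_coe (selectionKernel (J := κ₁) (ι := κ₃) q d c₀ s hu h₀) hT
  have hK' : ∀ z, Measurable fun f => selectionKernel (J := κ₁) (ι := κ₃) q d c₀ s hu h₀ (f, z) T :=
    fun z => hK.comp measurable_prodMk_right
  rw [batchSelectionKernel_apply _ _ _ _ _ _ _ _ _ hT,
    batchSelectionKernel_apply _ _ _ _ _ _ _ _ _ hT]
  obtain ⟨i, rfl⟩ := e.surjective i
  rcases i with ⟨j, l⟩ | l
  · have hz : (splitSample e S).2 = (splitSample e S').2 :=
      funext fun i => hS _ (by simp)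
    rw [hz]
    refine lintegral_pi_le_of_update_le _ _ j (fun i hi => ?_) (hK' _) fun f x =>
      selectionKernel_update_le hq ENNReal.ofReal_ne_top hd c₀ hs hu hu0 h₀ f j x _ hT
    congr 1
    exact funext fun r => hS _ (by simp [hi])
  · have hb : (splitSample e S).1 = (splitSample e S').1 :=
      funext fun i => funext fun r => hS _ (by simp)
    rw [hb]
    calc _ ≤ ∫⁻ f, (q ^ 2 * selectionKernel q d c₀ s hu h₀ (f, (splitSample e S').2) T +
          (1 + q) * d) ∂(Measure.pi fun j => G ((splitSample e S').1 j)) := by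
          refine lintegral_mono fun f => ?_
          exact selectionKernel_le_of_eq_of_ne hd c₀ hs hu hu0 hu1 h₀ f (j := l)
            (fun i hi => hS _ (by simpa using hi)) hT
      _ = _ := by
          rw [lintegral_add_right _ measurable_const, lintegral_const_mul _ (hK' _)]
          simp

end Learner
-- Choice of the parameters.
theorem exists_sample_sizes {m : ℕ} {η α β ε δ : ℝ} (hη : η ∈ Set.Ioc (0 : ℝ) 1)
    (hα : α ∈ Set.Ioo (0 : ℝ) 1) (hβ : β ∈ Set.Ioo (0 : ℝ) (1 / 2))
    (hε : ε ∈ Set.Ioo (0 : ℝ) 1) (hδ : δ ∈ Set.Ioo (0 : ℝ) 1) :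
    ∃ c₀ k l : ℕ, c₀ ≠ 0 ∧ l ≠ 0 ∧
      ((k * m + l : ℕ) : ℝ) ≤ 1000 * (m * Real.log (1 / (η * β * δ)) / (η * ε)
            + Real.log (1 / (η * β)) / (α * ε)) ∧
      2 ^ c₀ * (1 - η / 2) ^ k ≤ β / 3 ∧
      Real.exp (α * (ε / 4)) ^ l ≤ β / 3 * (δ / 4 * Real.exp (ε / 4) ^ (c₀ - 1)) ∧
      k * Real.exp (-(α * (ε / 4) / 8)) ^ l ≤ β / 3 * c₀ := by
  obtain ⟨hη0, hη1⟩ := hη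
  obtain ⟨hα0, hα1⟩ := hα
  obtain ⟨hβ0, hβ1⟩ := hβ
  obtain ⟨hε0, hε1⟩ := hε
  obtain ⟨hδ0, hδ1⟩ := hδ
  have hηβ : 0 < η * β := mul_pos hη0 hβ0
  have hηβδ : 0 < η * β * δ := mul_pos hηβ hδ0
  set L := Real.log (1 / (η * β * δ)) with hL
  set t := Real.log (1 / (η * β)) with ht
  have hexpt : Real.exp (-t) = η * β := by
    rw [ht, one_div, Real.log_inv, neg_neg, Real.exp_log hηβ]
  have hexpL : Real.exp (-L) = η * β * δ := by
    rw [hL, one_div, Real.log_inv, neg_neg, Real.exp_log hηβδ]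
  have hηβ1 : η * β ≤ 1 / 2 := by nlinarith
  have hlog2 : (1 : ℝ) / 2 ≤ Real.log 2 := by linarith [Real.log_two_gt_d9]
  have htL : t ≤ L := by
    refine Real.log_le_log (by positivity) ?_
    exact one_div_le_one_div_of_le hηβδ (mul_le_of_le_one_right hηβ.le hδ1.le)
  have ht2 : Real.log 2 ≤ t := by
    refine Real.log_le_log (by norm_num) ?_
    rw [le_div_iff₀ hηβ]
    linarith
  have ht0 : 1 / 2 ≤ t := hlog2.trans ht2
  have hL0 : 0 < L := by linarith
  -- A spare factor absorbing the numerical constants in all three error bounds below.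
  have h16 : Real.exp (-(4 * t)) ≤ 1 / 16 := by
    have : Real.exp (-(4 * t)) = (η * β) ^ 4 := by
      rw [← hexpt, ← Real.exp_nat_mul]; congr 1; push_cast; ring
    rw [this]
    calc (η * β) ^ 4 ≤ (1 / 2) ^ 4 := by gcongr
      _ = _ := by norm_num
  set s := ε / 4 with hs
  have hs0 : 0 < s := by positivity
  have hs1 : s ≤ 1 / 4 := by linarith
  -- `l` makes the bad candidates decay like `exp (-5 * t)`. The fallback then costs up to `exp (41
  -- * t)`, which `47 * L` outweighs with room for `L + 4 * t` and for the loss of `s` from the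
  -- exponent `c₀ - 1`. Finally `k` makes the mean number of copies of `h` at least `4 * c₀`.
  set c₀ := ⌈47 * L / s⌉₊ with hc₀
  set k := ⌈4 * c₀ / η⌉₊ with hk
  set l := ⌈40 * t / (α * s)⌉₊ with hl
  have hαs : 0 < α * s := by positivity
  have hαs1 : α * s ≤ 1 / 4 := by nlinarith
  have hLs : 2 ≤ L / s := by rw [le_div_iff₀ hs0]; linarith
  have hc1 : 47 * L / s ≤ c₀ := Nat.le_ceil _
  have hc2 : (c₀ : ℝ) ≤ 48 * (L / s) := by
    have : (c₀ : ℝ) ≤ 47 * L / s + 1 := (Nat.ceil_lt_add_one (by positivity)).le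
    rw [mul_div_assoc] at this
    linarith
  have hc3 : (1 : ℝ) ≤ c₀ := by rw [mul_div_assoc] at hc1; linarith
  have hc4 : 1 ≤ c₀ := by exact_mod_cast hc3
  have hk1 : 4 * c₀ / η ≤ k := Nat.le_ceil _
  have hk2 : (k : ℝ) ≤ 5 * c₀ / η := by
    have h1 : (k : ℝ) ≤ 4 * c₀ / η + 1 := (Nat.ceil_lt_add_one (by positivity)).le
    have h2 : 1 ≤ c₀ / η := by rw [le_div_iff₀ hη0]; linarith
    have h3 : 5 * c₀ / η = 4 * c₀ / η + c₀ / η := by ring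
    linarith
  have hl1 : 40 * t / (α * s) ≤ l := Nat.le_ceil _
  have htα : 2 ≤ t / (α * s) := by rw [le_div_iff₀ hαs]; linarith
  have hl2 : (l : ℝ) ≤ 41 * (t / (α * s)) := by
    have : (l : ℝ) ≤ 40 * t / (α * s) + 1 := (Nat.ceil_lt_add_one (by positivity)).le
    rw [mul_div_assoc] at this
    linarith
  have hl3 : (1 : ℝ) ≤ l := by rw [mul_div_assoc] at hl1; linarith
  have hl4 : 40 * t ≤ α * s * l := by rw [div_le_iff₀ hαs] at hl1; linarith
  have hl5 : α * s * l ≤ 41 * t := by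
    rw [← mul_div_assoc, le_div_iff₀ hαs] at hl2; linarith
  have hl6 : l ≠ 0 := by rintro h; rw [h] at hl3; norm_num at hl3
  refine ⟨c₀, k, l, by omega, hl6, ?_, ?_, ?_, ?_⟩
  · have h1 : (k : ℝ) ≤ 960 * (L / (η * ε)) := by
      calc (k : ℝ) ≤ 5 * c₀ / η := hk2
        _ ≤ 5 * (48 * (L / s)) / η := by gcongr
        _ = _ := by rw [hs]; field_simp; ring
    have h2 : (l : ℝ) ≤ 164 * (t / (α * ε)) := by
      calc (l : ℝ) ≤ 41 * (t / (α * s)) := hl2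
        _ = _ := by rw [hs]; field_simp; ring
    have h3 : 0 ≤ L / (η * ε) := by have := ht0.trans htL; positivity
    have h4 : 0 ≤ t / (α * ε) := by positivity
    push_cast
    calc (k * m + l : ℝ) ≤ 960 * (L / (η * ε)) * m + 164 * (t / (α * ε)) := by gcongr
      _ ≤ 1000 * (L / (η * ε)) * m + 1000 * (t / (α * ε)) := by gcongr <;> norm_num
      _ = _ := by ring
  · have h1 : 1 - η / 2 ≤ Real.exp (-(η / 2)) := by linarith [Real.add_one_le_exp (-(η / 2))]
    have h2 : (2 : ℝ) ≤ Real.exp 1 := by linarith [Real.add_one_le_exp 1]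
    have h3 : 4 * c₀ ≤ η * k := by rw [div_le_iff₀ hη0] at hk1; linarith
    have h4 : 5 * t ≤ c₀ := by
      have h5 : L ≤ L / s := by
        rw [le_div_iff₀ hs0]
        exact mul_le_of_le_one_right hL0.le (by linarith)
      rw [mul_div_assoc] at hc1
      linarith
    calc (2 : ℝ) ^ c₀ * (1 - η / 2) ^ k ≤ Real.exp 1 ^ c₀ * Real.exp (-(η / 2)) ^ k := by
          gcongr
          · exact pow_nonneg (by linarith) _
          · linarith
      _ = Real.exp (c₀ - η * k / 2) := by
          rw [← Real.exp_nat_mul, ← Real.exp_nat_mul, ← Real.exp_add]; congr 1; ring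
      _ ≤ Real.exp (-t + -(4 * t)) := by gcongr; linarith
      _ ≤ η * β * (1 / 16) := by rw [Real.exp_add, hexpt]; gcongr
      _ ≤ 1 * β * (1 / 16) := by gcongr
      _ ≤ β / 3 := by linarith
  · have h1 : 47 * L - s ≤ s * ((c₀ - 1 : ℕ) : ℝ) := by
      rw [Nat.cast_sub hc4]
      rw [div_le_iff₀ hs0] at hc1
      push_cast
      linarith
    rw [← Real.exp_nat_mul, ← Real.exp_nat_mul]
    have h2 : Real.exp (l * (α * s)) ≤
        Real.exp (-L) * Real.exp (-(4 * t)) * Real.exp ((c₀ - 1 : ℕ) * s) := by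
      rw [← Real.exp_add, ← Real.exp_add]
      gcongr
      linarith
    refine h2.trans ?_
    rw [hexpL, ← mul_assoc]
    refine mul_le_mul_of_nonneg_right ?_ (Real.exp_pos _).le
    calc η * β * δ * Real.exp (-(4 * t)) ≤ 1 * β * δ * (1 / 16) := by gcongr
      _ ≤ β / 3 * (δ / 4) := by nlinarith [mul_pos hβ0 hδ0]
  · rw [← Real.exp_nat_mul]
    -- The factor `η` in `exp (-t) = η * β` cancels the `1 / η` in `k`.
    calc _ ≤ 5 * c₀ / η * Real.exp (-t + -(4 * t)) := by
          gcongr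
          linarith
      _ ≤ 5 * c₀ / η * (η * β * (1 / 16)) := by rw [Real.exp_add, hexpt]; gcongr
      _ = 5 / 16 * (β * c₀) := by field_simp
      _ ≤ _ := by linarith [mul_nonneg hβ0.le (zero_le_one.trans hc3)]

/-! ### The zero-one loss and the conclusion. -/

theorem zeroOneLoss_eq_zero_or_one {K : ℕ} (y' y : Fin K) :
    zeroOneLoss y' y = 0 ∨ zeroOneLoss y' y = 1 := by
  unfold zeroOneLoss
  split_ifs <;> simp

theorem measurable_zeroOneLoss_eval {X : Type*} [MeasurableSpace X] {K : ℕ}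
    {F : Set (X → Fin K)} [MeasurableSpace F]
    (hF : Measurable fun p : F × X => (p.1 : X → Fin K) p.2) :
    Measurable (Function.uncurry fun (h : F) (z : X × Fin K) =>
      zeroOneLoss ((h : X → Fin K) z.1) z.2) := by
  have h1 : Measurable fun p : F × (X × Fin K) => ((p.1 : X → Fin K) p.2.1, p.2.2) :=
    (hF.comp (measurable_fst.prodMk (measurable_fst.comp measurable_snd))).prodMk
      (measurable_snd.comp measurable_snd)
  exact (Measurable.of_discrete (f := fun p : Fin K × Fin K => zeroOneLoss p.1 p.2)).comp h1

theorem pow_le_countWeight {q d : ℝ≥0∞} {c₀ : ℕ} (hc₀ : c₀ ≠ 0) :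
    d * q ^ (c₀ - 1) ≤ countWeight q d c₀ c₀ := by
  unfold countWeight
  gcongr
  exact Finset.single_le_sum (f := fun i => q ^ i) (fun _ _ => zero_le)
    (Finset.mem_range.2 (by omega))

theorem mainTheorem6 :
    ∃ C : ℝ, 0 < C ∧
      ∀ (X : Type*) [MeasurableSpace X] (K : ℕ), 2 ≤ K →
      ∀ (𝓕 : Set (X → Fin K)) [MeasurableSpace 𝓕] [MeasurableEq 𝓕],
        (Measurable fun p : 𝓕 × X => (p.1 : X → Fin K) p.2) →
      ∀ H : Set (X → Fin K), (∀ h ∈ H, Measurable h) →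
      ∀ (m : ℕ) (G : Kernel (LabelledSample X K m) 𝓕) [IsMarkovKernel G]
        (η α β ε δ : ℝ),
        η ∈ Set.Ioc (0 : ℝ) 1 → α ∈ Set.Ioo (0 : ℝ) 1 → β ∈ Set.Ioo (0 : ℝ) (1 / 2) →
        ε ∈ Set.Ioo (0 : ℝ) 1 → δ ∈ Set.Ioo (0 : ℝ) 1 →
        ∃ n : ℕ,
          (n : ℝ) ≤ C * (m * Real.log (1 / (η * β * δ)) / (η * ε)
            + Real.log (1 / (η * β)) / (α * ε)) ∧
          ∃ M : Kernel (LabelledSample X K n) 𝓕, IsMarkovKernel M ∧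
            DifferentiallyPrivate ε δ M ∧
            ∀ (D : Measure (X × Fin K)) [IsProbabilityMeasure D], Realizable H D →
              (∃ h : 𝓕, ENNReal.ofReal η ≤ outputLaw G D {h} ∧ populationLoss D h ≤ α / 2) →
              ENNReal.ofReal (1 - β) ≤ outputLaw M D {h : 𝓕 | populationLoss D h ≤ α} := by
  refine ⟨1000, by norm_num, ?_⟩
  intro X _ K hK 𝓕 _ _ hF H _ m G _ η α β ε δ hη hα hβ hε hδ
  obtain ⟨c₀, k, l, hc₀, hl, hn, h1, h2, h3⟩ := exists_sample_sizes (m := m) hη hα hβ hε hδ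
  refine ⟨k * m + l, hn, ?_⟩
  rcases isEmpty_or_nonempty 𝓕 with hempty | ⟨⟨h₀⟩⟩
  -- Without outputs there is no fallback. Since `l ≠ 0`, a sample would supply an example to feed
  -- to `G`, giving a probability measure on an empty type; hence there are no samples and the zero
  -- kernel is vacuously Markov.
  · have hX : IsEmpty (LabelledSample X K (k * m + l)) := by
      refine ⟨fun S => ?_⟩
      have S' : LabelledSample X K m := fun _ => S ⟨0, by omega⟩
      have := nonempty_of_isProbabilityMeasure (G S')
      exact hempty.false this.some
    exact ⟨0, ⟨fun S => hX.elim S⟩, fun S => hX.elim S,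
      fun D _ _ ⟨h, _⟩ => hempty.elim h⟩
  obtain ⟨hε0, hε1⟩ := hε
  obtain ⟨hδ0, hδ1⟩ := hδ
  obtain ⟨hα0, hα1⟩ := hα
  obtain ⟨hβ0, hβ1⟩ := hβ
  have hs0 : 0 ≤ ε / 4 := by linarith
  set u : 𝓕 → X × Fin K → ℝ := fun h z => zeroOneLoss ((h : X → Fin K) z.1) z.2
  have hu : Measurable (Function.uncurry u) := measurable_zeroOneLoss_eval hF
  have hu01 : ∀ h z, u h z = 0 ∨ u h z = 1 := fun h z => zeroOneLoss_eq_zero_or_one _ _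
  have hu0 : ∀ h z, 0 ≤ u h z := fun h z => by rcases hu01 h z with h | h <;> simp [h]
  have hu1 : ∀ h z, u h z ≤ 1 := fun h z => by rcases hu01 h z with h | h <;> simp [h]
  have huh : ∀ h, Measurable (u h) := fun h => hu.comp measurable_prodMk_left
  set q := ENNReal.ofReal (Real.exp (ε / 4)) with hq
  set d := ENNReal.ofReal (δ / 4) with hd
  have hq1 : 1 ≤ q := by simpa [hq] using hs0
  have hd0 : d ≠ 0 := by simpa [hd] using hδ0
  let e : (Fin k × Fin m) ⊕ Fin l ≃ Fin (k * m + l) :=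
    (Equiv.sumCongr finProdFinEquiv (Equiv.refl _)).trans finSumFinEquiv
  let M := batchSelectionKernel q d c₀ (ε / 4) hu h₀ G e
  have hM : IsMarkovKernel M := by
    have := isMarkovKernel_selectionKernel (J := Fin k) (ι := Fin l) (q := q) (d := d)
      ENNReal.ofReal_ne_top ENNReal.ofReal_ne_top c₀ (ε / 4) hu h₀
    unfold M batchSelectionKernel
    infer_instance
  refine ⟨M, hM, ?_, ?_⟩
  · rintro S S' ⟨i, -, hi⟩ T hT
    refine (batchSelectionKernel_le ENNReal.ofReal_ne_top c₀ hs0 hu hu0 hu1 h₀ G e hi hT).trans ?_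
    refine add_le_add (mul_le_mul_left ?_ _) ?_
    · rw [← ENNReal.ofReal_pow (Real.exp_pos _).le, ← Real.exp_nat_mul]
      refine ENNReal.ofReal_le_ofReal (Real.exp_le_exp.2 ?_)
      push_cast
      linarith
    · rw [← ENNReal.ofReal_one, ← ENNReal.ofReal_add zero_le_one (Real.exp_pos _).le,
        ← ENNReal.ofReal_mul (by positivity)]
      -- Here `exp (ε / 4) ≤ 3`, so `1 + q ≤ 4`, which the choice `d = δ / 4` compensates.
      refine ENNReal.ofReal_le_ofReal ?_
      have h4 := (exp_bounds hs0 (by linarith)).1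
      have h5 : (ε / 4) ^ 2 ≤ 1 := pow_le_one₀ hs0 (by linarith)
      have h6 : (1 + Real.exp (ε / 4)) * (δ / 4) ≤ 4 * (δ / 4) := by
        gcongr
        linarith
      linarith
  · intro D _ _ ⟨h, hηh, hh⟩
    have : IsProbabilityMeasure (outputLaw G D) := by
      unfold outputLaw
      infer_instance
    have : IsProbabilityMeasure (outputLaw M D) := by
      unfold outputLaw
      infer_instance
    set T : Set 𝓕 := {h | populationLoss D h ≤ α}
    have hT : MeasurableSet T := by
      have : StronglyMeasurable fun h => ∫ z, u h z ∂D :=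
        hu.stronglyMeasurable.integral_prod_right
      exact measurableSet_le this.measurable measurable_const
    -- The failure probability splits into three parts of at most `β / 3`: too few copies of `h`,
    -- the fallback, and bad candidates.
    have hbad : outputLaw M D Tᶜ ≤ ENNReal.ofReal β := by
      have hb := selectionKernel_comp_le (J := Fin k) (ι := Fin l) hq1 ENNReal.ofReal_ne_top hd0
        ENNReal.ofReal_ne_top hc₀ (ε / 4) hu h₀ (outputLaw G D) D h hT.compl
        (lintegral_exp_loss_le D (huh h) (hu01 h) hs0 (by linarith) hα0.le hh)
        (fun b hb => lintegral_exp_loss_sub_le D (huh h) (hu01 h) (huh b) (hu01 b) hs0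
          (by linarith) hα0.le hh (not_le.1 (show ¬populationLoss D b ≤ α from hb)).le)
      have hlaw := pi_bind_batchSelectionKernel q d c₀ (ε / 4) hu h₀ G e D
      rw [show outputLaw M D = _ from hlaw]
      refine hb.trans ?_
      have hb1 := (measure_occurrences_lt_le (J := Fin k) (outputLaw G D) hηh c₀).trans
        (ENNReal.ofReal_le_ofReal (by simpa using h1))
      have hb2 : (countWeight q d c₀ c₀)⁻¹ *
          ENNReal.ofReal (Real.exp (α * (ε / 4))) ^ Fintype.card (Fin l) ≤
            ENNReal.ofReal (β / 3) := by
        rw [mul_comm, ← div_eq_mul_inv, Fintype.card_fin]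
        refine ENNReal.div_le_of_le_mul (le_trans ?_ (mul_le_mul_right (pow_le_countWeight hc₀) _))
        rw [← ENNReal.ofReal_pow (Real.exp_pos _).le, ← ENNReal.ofReal_pow (Real.exp_pos _).le,
          ← ENNReal.ofReal_mul (by positivity), ← ENNReal.ofReal_mul (by positivity)]
        exact ENNReal.ofReal_le_ofReal h2
      have hb3 : (Fintype.card (Fin k) : ℝ≥0∞) * ((c₀ : ℝ≥0∞)⁻¹ *
          ENNReal.ofReal (Real.exp (-(α * (ε / 4) / 8))) ^ Fintype.card (Fin l)) ≤
            ENNReal.ofReal (β / 3) := by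
        rw [mul_left_comm, mul_comm, ← div_eq_mul_inv, Fintype.card_fin, Fintype.card_fin]
        refine ENNReal.div_le_of_le_mul ?_
        rw [← ENNReal.ofReal_pow (Real.exp_pos _).le, ← ENNReal.ofReal_natCast,
          ← ENNReal.ofReal_natCast, ← ENNReal.ofReal_mul (by positivity),
          ← ENNReal.ofReal_mul (by positivity)]
        exact ENNReal.ofReal_le_ofReal h3
      refine (add_le_add hb1 (add_le_add hb2 hb3)).trans_eq ?_
      rw [← ENNReal.ofReal_add (by positivity) (by positivity),
        ← ENNReal.ofReal_add (by positivity) (by positivity)]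
      congr 1
      ring
    rw [prob_compl_eq_one_sub hT] at hbad
    rw [ENNReal.ofReal_sub _ hβ0.le, ENNReal.ofReal_one]
    exact tsub_le_iff_tsub_le.1 hbad
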